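/- Let $3\le p<q<r$ be primes and let $G=(p,q,r)=\langle x,y\mid x^p=y^q=(xy)^r=1\rangle$ be the triangle group. A *$(p,q,r)$-diagram* $K$ consists of a finite directed graph with edges labelled $x$ and $y$, such that every vertex has exactly one outgoing and exactly one incoming arc of each label, and such that for every vertex $v$ the closed walks obtained by starting at $v$ and repeating the word $x$, respectively $y$, respectively $xy$, until the walk first closes up (these walks bound the faces of $K$ in its standard embedding in a surface) have labels $x^k$, $y^l$, $(xy)^m$ with $k\mid p$, $l\mid q$, $m\mid r$. Write $|K|$ for the number of vertices of $K$. For $g\in G$ let $\theta_K(g)$ be the permutation of the vertices that sends $v$ to the terminal vertex $v^g$ of the path that starts at $v$ and has label $g$ (read from left to right); its *cycle structure* is the function $\mathbf{s}$ for which $\mathbf{s}(i)$ is the number of cycles of length $i$ of $\theta_K(g)$. A *handle* of $K$ is a pair of distinct vertices $\alpha,\beta$, each incident with an $x$-loop, such that $\alpha^{xy}=\beta$; different handles are required to be disjoint. Suppose that $K_1,K_2,K_3$ are path-connected $(p,q,r)$-diagrams such that 1. $|K_1|$ and $|K_2|$ are relatively prime, and $|K_3|\ge q+3$; 2. $K_1$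 and $K_2$ each contain at least two (disjoint) handles, and $K_3$ contains a handle $\{\alpha,\beta\}$; 3. if $\mathbf{s}_i$ is the cycle structure of $\theta_{K_i}(x^{-1}y)$, then $\mathbf{s}_1(kq)=\mathbf{s}_2(kq)=0$ for all $k\ge 1$, while $\mathbf{s}_3(q)=1$ and $\mathbf{s}_3(kq)=0$ for all $k>1$; 4. if $\mu$ is the unique $q$-cycle of $\theta_{K_3}(x^{-1}y)$, there are points $i,j$ of $\mu$, neither of them equal to $\alpha$ or $\beta$, such that $i^x$ and $j^y$ are also points of $\mu$. Then $G$ surjects almost all of the alternating groups: for all but finitely many $n$ there is a surjective homomorphism $G\to A_n$. -/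

import Mathlib

namespace HigmanTriangle

/-- The two generators `x`, `y` of a triangle group; also the labels of the arcs of a diagram. -/
inductive Gen : Type
  | x : Gen
  | y : Gen

/-- The relators `x ^ p`, `y ^ q`, `(x y) ^ r`. -/
def relators (p q r : ℕ) : Set (FreeGroup Gen) :=
  {FreeGroup.of Gen.x ^ p, FreeGroup.of Gen.y ^ q,
    (FreeGroup.of Gen.x * FreeGroup.of Gen.y) ^ r}

/-- The triangle group `(p, q, r) = ⟨x, y | x ^ p = y ^ q = (x y) ^ r = 1⟩`. -/
abbrev TriangleGroup (p q r : ℕ) : Type := PresentedGroup (relators p q r)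

/-- The generator `x` of the triangle group. -/
def genX (p q r : ℕ) : TriangleGroup p q r := PresentedGroup.of Gen.x

/-- The generator `y` of the triangle group. -/
def genY (p q r : ℕ) : TriangleGroup p q r := PresentedGroup.of Gen.y

/-- A `(p, q, r)`-diagram with vertex set `V`.

The underlying directed graph has, for each vertex `v` and each label, exactly one arc with that
label leaving `v` and exactly one entering `v`; so it is given by the two permutations `arcX`,
`arcY` of `V` sending a vertex to the terminal vertex of the `x`-arc (`y`-arc) that leaves it.
In the standard embedding of this graph in a closed oriented surface the faces are the
`x`-faces, the `y`-faces and the `xy`-faces. The face of each kind through `v` is bounded by the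
closed walk that starts at `v` and repeats the word `x`, `y` or `x y` until it first closes up,
so its boundary label is `x ^ k`, `y ^ k` or `(x y) ^ k` with `k` the minimal period of `v`.
For a diagram these exponents have to divide `p`, `q` and `r` respectively. -/
structure Diagram (p q r : ℕ) (V : Type*) where
  /-- the terminal vertex of the `x`-arc that leaves a given vertex -/
  arcX : Equiv.Perm V
  /-- the terminal vertex of the `y`-arc that leaves a given vertex -/
  arcY : Equiv.Perm V
  /-- every `x`-face has boundary label `x ^ k` with `k ∣ p` -/
  face_x : ∀ v, Function.minimalPeriod arcX v ∣ p
  /-- every `y`-face has boundary label `y ^ k` with `k ∣ q` -/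
  face_y : ∀ v, Function.minimalPeriod arcY v ∣ q
  /-- every `xy`-face has boundary label `(x y) ^ k` with `k ∣ r` -/
  face_xy : ∀ v, Function.minimalPeriod (fun u => arcY (arcX u)) v ∣ r

namespace Diagram

variable {p q r : ℕ} {V : Type*}

/-- The permutation of the vertices given by the arcs with a given label. -/
def arc (K : Diagram p q r V) : Gen → Equiv.Perm V
  | Gen.x => K.arcX
  | Gen.y => K.arcY

/-- For a word `w`, the permutation `(K.walk w).unop` sends a vertex `v` to the terminal vertex of
the path that starts at `v` and has label `w`, read from left to right. (Permutations of `V`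
compose from right to left, hence the opposite group.) -/
def walk (K : Diagram p q r V) : FreeGroup Gen →* (Equiv.Perm V)ᵐᵒᵖ :=
  FreeGroup.lift fun g => MulOpposite.op (K.arc g)

theorem perm_pow_eq_one {σ : Equiv.Perm V} {n : ℕ}
    (h : ∀ v, Function.minimalPeriod σ v ∣ n) : σ ^ n = 1 := by
  ext v
  have hv : Function.IsPeriodicPt σ n v := Function.isPeriodicPt_iff_minimalPeriod_dvd.mpr (h v)
  have hv' : σ^[n] v = v := hv
  rwa [Equiv.Perm.iterate_eq_pow] at hv'

/-- In a diagram every path labelled by a relator is closed. -/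
theorem walk_relators (K : Diagram p q r V) : ∀ w ∈ relators p q r, K.walk w = 1 := by
  intro w hw
  rcases hw with rfl | rfl | rfl
  · simp only [walk, map_pow, FreeGroup.lift_apply_of, arc]
    rw [← MulOpposite.op_pow, perm_pow_eq_one K.face_x, MulOpposite.op_one]
  · simp only [walk, map_pow, FreeGroup.lift_apply_of, arc]
    rw [← MulOpposite.op_pow, perm_pow_eq_one K.face_y, MulOpposite.op_one]
  · have h : (K.arcY * K.arcX) ^ r = 1 := perm_pow_eq_one K.face_xy
    simp only [walk, map_pow, map_mul, FreeGroup.lift_apply_of, arc]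
    rw [← MulOpposite.op_mul, ← MulOpposite.op_pow, h, MulOpposite.op_one]

/-- The homomorphism from the triangle group to the permutations of the vertices (acting on the
right) that is given by the diagram. -/
def thetaHom (K : Diagram p q r V) : TriangleGroup p q r →* (Equiv.Perm V)ᵐᵒᵖ :=
  PresentedGroup.toGroup (f := fun g => MulOpposite.op (K.arc g)) K.walk_relators

/-- The permutation of the vertices that sends `v` to the terminal vertex of the path that starts
at `v` and has label `g`. -/
def theta (K : Diagram p q r V) (g : TriangleGroup p q r) : Equiv.Perm V :=
  (K.thetaHom g).unop

/-- The underlying graph is connected: any two vertices are joined by a path of arcs, each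
traversed forwards or backwards. -/
def PathConnected (K : Diagram p q r V) : Prop :=
  Nonempty V ∧
    ∀ u v : V, Relation.EqvGen (fun a b => ∃ g : Gen, K.arc g a = b) u v

/-- `(α, β)` is a handle: two distinct vertices, each incident with an `x`-loop, such that the path
that starts at `α` and has label `x y` terminates at `β`. -/
def IsHandle (K : Diagram p q r V) (α β : V) : Prop :=
  α ≠ β ∧ K.arcX α = α ∧ K.arcX β = β ∧ K.theta (genX p q r * genY p q r) α = β

/-- The diagram contains (at least) two handles; as always for a collection of handles, their
four vertices are distinct. -/
def HasTwoHandles (K : Diagram p q r V) : Prop :=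
  ∃ α₁ β₁ α₂ β₂ : V, K.IsHandle α₁ β₁ ∧ K.IsHandle α₂ β₂ ∧
    α₁ ≠ α₂ ∧ α₁ ≠ β₂ ∧ β₁ ≠ α₂ ∧ β₁ ≠ β₂

end Diagram

/-- The cycle structure of a permutation `σ`: the number of cycles of length `i` (fixed points being
cycles of length `1`) when `σ` is written as a product of disjoint cycles. -/
def cycleStructure {V : Type*} [Fintype V] [DecidableEq V] (σ : Equiv.Perm V) (i : ℕ) : ℕ :=
  σ.partition.parts.count i

/-- `G` surjects almost all, i.e. all but finitely many, of the alternating groups. -/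
def SurjectsAlmostAllAlternating (G : Type*) [Group G] : Prop :=
  {n : ℕ | ¬ ∃ f : G →* alternatingGroup (Fin n), Function.Surjective f}.Finite

end HigmanTriangle

/-! Since `x` fixes both points of a handle, `p` handles `(a s, b s)` can be joined by letting `x`
rotate the points `a s` and rotate the points `b s` the opposite way. Then `x ^ p = 1` survives and
`y` is unchanged. As `y` carries `a s` to `b s`, the permutations of `x y` and `x⁻¹ y` are merely
conjugated (`mul_joinX`, `mul_joinX_inv`), so the result is again a diagram. One copy of `K₃` and at
least `2 * p` copies of `K₁` and `K₂` have enough handles to be joined into a connected diagram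
(`exists_arrangement`), and by coprimality every large `n` occurs as its number of vertices.

Some power of `x⁻¹ y`, with exponent prime to `q`, is trivial on `K₁` and `K₂` and is a `q`-cycle
with the support of `μ` on `K₃`; after joining it is still a `q`-cycle. The points `i`, `j` then
force primitivity (`isPreprimitive_closure`), and Jordan's theorem gives the alternating group.
Conversely the generators have odd order, so they are even permutations. -/

namespace HigmanTriangle

open Equiv Equiv.Perm MulAction

/-! ### Jordan's theorem on cycles of prime length -/

section Jordan

variable {Ω : Type*} [Fintype Ω] [DecidableEq Ω]

/-- `F` embeds in the symmetric group on the `q` points of `c.support`, and `q` divides `q!` exactly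
once. Hence `⟨c⟩` is a Sylow `q`-subgroup of `F`. -/
theorem factorization_card_eq_one {q : ℕ} (hq : q.Prime) {c : Perm Ω}
    (hc : c.IsCycle) (hcq : c.support.card = q) {F : Subgroup (Perm Ω)} (hcF : c ∈ F)
    (hF : ∀ g ∈ F, g.support ⊆ c.support) : (Nat.card F).factorization q = 1 := by
  have hle : F ≤ (ofSubtype : Perm {a // a ∈ c.support} →* Perm Ω).range := by
    intro g hg
    rw [mem_range_ofSubtype_iff]
    exact_mod_cast hF g hg
  have hdvd : Nat.card F ∣ q.factorial := by
    refine (Subgroup.card_dvd_of_le hle).trans ?_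
    refine (Subgroup.card_range_dvd _).trans ?_
    rw [Nat.card_perm, Nat.card_eq_fintype_card, Fintype.card_coe, hcq]
  have hpos : Nat.card F ≠ 0 := Nat.card_pos.ne'
  apply le_antisymm
  · have h1 := (Nat.factorization_le_iff_dvd hpos q.factorial_ne_zero).2 hdvd q
    have h2 : q.factorial.factorization q = 1 := by
      simpa using Nat.factorization_factorial_mul (n := 1) hq
    omega
  · have h1 : q ∣ Nat.card F := by
      have := orderOf_dvd_natCard (⟨c, hcF⟩ : F)
      rwa [Subgroup.orderOf_mk, hc.orderOf, hcq] at this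
    exact (hq.dvd_iff_one_le_factorization hpos).1 h1

/-- Frattini argument: `g` preserves the fixed-point set of `c`, so `⟨c⟩` and its conjugate by `g`
are Sylow subgroups of the pointwise stabilizer of that set. An element `h` of the stabilizer
conjugates one back to the other, and `u = h * g`. -/
theorem exists_mem_conj_mem_zpowers {q : ℕ} (hq : q.Prime) {G : Subgroup (Perm Ω)} {c : Perm Ω}
    (hc : c.IsCycle) (hcq : c.support.card = q) (hcG : c ∈ G) {g : Perm Ω} (hg : g ∈ G)
    (hgc : ∀ a, a ∉ c.support → g a ∉ c.support) :
    ∃ u ∈ G, (∀ a, a ∉ c.support → u a = g a) ∧ u * c * u⁻¹ ∈ Subgroup.zpowers c := by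
  have : Fact q.Prime := ⟨hq⟩
  let F : Subgroup (Perm Ω) := G ⊓ fixingSubgroup (Perm Ω) ((c.support : Set Ω)ᶜ)
  have hmemF : ∀ f, f ∈ F ↔ f ∈ G ∧ ∀ a, a ∉ c.support → f a = a := by
    intro f
    simp only [F, Subgroup.mem_inf, mem_fixingSubgroup_iff, Set.mem_compl_iff, Finset.mem_coe,
      Perm.smul_def]
  have hF : ∀ f ∈ F, f.support ⊆ c.support := by
    intro f hf a ha
    by_contra h
    exact (mem_support.1 ha) (((hmemF f).1 hf).2 a h)
  have hcF : c ∈ F := (hmemF c).2 ⟨hcG, fun a ha => notMem_support.1 ha⟩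
  have hginv : ∀ a, a ∉ c.support → g⁻¹ a ∉ c.support := by
    have hsub : (c.supportᶜ).map g.toEmbedding ⊆ c.supportᶜ := by
      intro b hb
      obtain ⟨a, ha, rfl⟩ := Finset.mem_map.1 hb
      exact Finset.mem_compl.2 (hgc a (Finset.mem_compl.1 ha))
    have heq := Finset.eq_of_subset_of_card_le hsub (by simp)
    intro a ha
    rw [← Finset.mem_compl, ← heq] at ha
    obtain ⟨b, hb, rfl⟩ := Finset.mem_map.1 ha
    simpa using hb
  have hdF : g * c * g⁻¹ ∈ F := by
    refine (hmemF _).2 ⟨mul_mem (mul_mem hg hcG) (inv_mem hg), fun a ha => ?_⟩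
    have := notMem_support.1 (hginv a ha)
    simp only [Perm.mul_apply, this]
    simp
  have hfac := factorization_card_eq_one hq hc hcq hcF hF
  have hcard : ∀ x : F, orderOf x = q →
      Nat.card (Subgroup.zpowers x) = q ^ (Nat.card F).factorization q := by
    intro x hx
    rw [Nat.card_zpowers, hx, hfac, pow_one]
  have hoc : orderOf (⟨c, hcF⟩ : F) = q := by rw [Subgroup.orderOf_mk, hc.orderOf, hcq]
  have hod : orderOf (⟨g * c * g⁻¹, hdF⟩ : F) = q := by
    rw [Subgroup.orderOf_mk, hc.conj.orderOf, support_conj, Finset.card_map, hcq]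
  let P := Sylow.ofCard _ (hcard _ hoc)
  let Q := Sylow.ofCard _ (hcard _ hod)
  obtain ⟨h, hh⟩ := exists_smul_eq F Q P
  have hmem : h * ⟨g * c * g⁻¹, hdF⟩ * h⁻¹ ∈ Subgroup.zpowers (⟨c, hcF⟩ : F) := by
    have h1 : h * ⟨g * c * g⁻¹, hdF⟩ * h⁻¹ ∈ ((h • Q : Sylow q F) : Subgroup F) := by
      rw [Sylow.coe_subgroup_smul, ← MulAut.conj_apply, ← MulAut.smul_def]
      exact Subgroup.smul_mem_pointwise_smul _ _ _ (Subgroup.mem_zpowers _)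
    rw [hh] at h1
    exact h1
  obtain ⟨k, hk⟩ := Subgroup.mem_zpowers_iff.1 hmem
  refine ⟨h * g, mul_mem ((hmemF _).1 h.2).1 hg, fun a ha => ?_, ?_⟩
  · rw [Perm.mul_apply, ((hmemF _).1 h.2).2 _ (hgc a ha)]
  · refine Subgroup.mem_zpowers_iff.2 ⟨k, ?_⟩
    have := congrArg Subtype.val hk
    simp only [Subgroup.coe_mul, Subgroup.coe_inv, Subgroup.coe_zpow] at this
    rw [this]
    group

/-- Both conjugations act on `⟨c⟩` as power maps, and power maps commute; so the commutator
centralizes `c`. -/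
theorem commute_of_conj_mem_zpowers {Γ : Type*} [Group Γ] {c u v : Γ}
    (hu : u * c * u⁻¹ ∈ Subgroup.zpowers c) (hv : v * c * v⁻¹ ∈ Subgroup.zpowers c) :
    Commute ((v * u)⁻¹ * (u * v)) c := by
  obtain ⟨a, ha⟩ := Subgroup.mem_zpowers_iff.1 hu
  obtain ⟨b, hb⟩ := Subgroup.mem_zpowers_iff.1 hv
  have h1 : (u * v) * c * (u * v)⁻¹ = c ^ (a * b) := by
    have : (u * v) * c * (u * v)⁻¹ = u * (v * c * v⁻¹) * u⁻¹ := by group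
    rw [this, ← hb, ← conj_zpow, ← ha, zpow_mul]
  have h2 : (v * u) * c * (v * u)⁻¹ = c ^ (a * b) := by
    have : (v * u) * c * (v * u)⁻¹ = v * (u * c * u⁻¹) * v⁻¹ := by group
    rw [this, ← ha, ← conj_zpow, ← hb, ← zpow_mul, mul_comm]
  have h3 : (u * v) * c = c ^ (a * b) * (u * v) := by rw [← h1]; group
  have h4 : c * (v * u)⁻¹ = (v * u)⁻¹ * c ^ (a * b) := by rw [← h2]; group
  change _ * c = c * _
  rw [mul_assoc, h3, ← mul_assoc, ← mul_assoc, ← h4]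
  simp only [mul_assoc]

theorem isThreeCycle_pow {t : Perm Ω} (ht : t.IsThreeCycle) {q : ℕ} (hq : ¬ 3 ∣ q) :
    (t ^ q).IsThreeCycle := by
  have h3 : t ^ q = t ^ (q % 3) := by
    rw [← ht.orderOf, pow_mod_orderOf]
  have : q % 3 = 1 ∨ q % 3 = 2 := by omega
  rcases this with h | h
  · rw [h3, h, pow_one]; exact ht
  · rw [h3, h, pow_two]; exact ht.isThreeCycle_sq

/-- Jordan's theorem: a primitive permutation group that contains a cycle of prime length `q > 3`
with at least three fixed points contains the alternating group. -/
theorem alternatingGroup_le_of_isPreprimitive_of_isCycle_mem {G : Subgroup (Perm Ω)}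
    (hG : IsPreprimitive G Ω) {q : ℕ} (hq : q.Prime) (hq3 : 3 < q) (hcard : q + 3 ≤ Nat.card Ω)
    {c : Perm Ω} (hc : c.IsCycle) (hcq : c.support.card = q) (hcG : c ∈ G) :
    alternatingGroup Ω ≤ G := by
  have hcompl : c.supportᶜ.card + q = Nat.card Ω := by
    rw [← hcq, Finset.card_compl_add_card, Nat.card_eq_fintype_card]
  obtain ⟨k, hk⟩ : ∃ k, c.supportᶜ.card = k + 3 := ⟨_, (Nat.sub_add_cancel (by omega)).symm⟩
  -- The stabilizer of the `k + 3` fixed points of `c` is transitive on the other `q` points, hence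
  -- primitive since `q` is prime. Jordan's criterion then makes `G` multiply transitive, enough to
  -- prescribe the images of all fixed points of `c`.
  have htrans : IsMultiplyPretransitive G Ω (k + 3) := by
    have h1 : IsMultiplyPreprimitive G Ω (k + 2 + 2) := by
      apply hG.isMultiplyPreprimitive (s := ((c.support : Set Ω)ᶜ))
      · rw [← Finset.coe_compl, Set.ncard_coe_finset, hk]
      · omega
      · have := isPretransitive_of_isCycle_mem hc hcG
        apply IsPreprimitive.of_prime_card
        convert! hq
        rw [← hcq, ← Nat.card_eq_finsetCard]
        exact Nat.card_congr (Equiv.subtypeEquivRight fun x => by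
          simp [SubMulAction.mem_ofFixingSubgroup_iff])
    have h2 : IsMultiplyPretransitive G Ω (k + 2 + 2) := h1.isMultiplyPretransitive
    exact isMultiplyPretransitive_of_le' (n := k + 2 + 2) (by omega)
      (by rw [ENat.card_eq_coe_natCard]; exact_mod_cast (by omega))
  have hswap : ∀ s : Perm Ω, s.support ⊆ c.supportᶜ →
      ∃ u ∈ G, (∀ a, a ∉ c.support → u a = s a) ∧ u * c * u⁻¹ ∈ Subgroup.zpowers c := by
    intro s hs
    have hsc : ∀ a, a ∉ c.support → s a ∉ c.support := by
      intro a ha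
      by_cases h : s a = a
      · rwa [h]
      · exact Finset.mem_compl.1 (hs (apply_mem_support.2 (mem_support.2 h)))
    let e : Fin (k + 3) ≃ {x // x ∈ c.supportᶜ} := (Finset.equivFinOfCardEq hk).symm
    let e1 : Fin (k + 3) ↪ Ω := e.toEmbedding.trans (Function.Embedding.subtype _)
    obtain ⟨g, hg⟩ := exists_smul_eq G e1 (e1.trans s.toEmbedding)
    have hgs : ∀ a, a ∉ c.support → (g : Perm Ω) a = s a := by
      intro a ha
      have := DFunLike.congr_fun hg (e.symm ⟨a, Finset.mem_compl.2 ha⟩)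
      have h2 : g • a = s a := by simpa [e1] using this
      exact h2
    obtain ⟨u, hu, hug, huc⟩ := exists_mem_conj_mem_zpowers hq hc hcq hcG g.2
      (fun a ha => by rw [hgs a ha]; exact hsc a ha)
    exact ⟨u, hu, fun a ha => (hug a ha).trans (hgs a ha), huc⟩
  obtain ⟨a, b, d, ha, hb, hd, hab, had, hbd⟩ :=
    Finset.two_lt_card_iff.1 (show 2 < c.supportᶜ.card by omega)
  have hsub : ∀ y ∈ c.supportᶜ, a ≠ y → (swap a y).support ⊆ c.supportᶜ := by
    intro y hy hay
    rw [support_swap hay]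
    intro z hz
    simp only [Finset.mem_insert, Finset.mem_singleton] at hz
    rcases hz with rfl | rfl <;> assumption
  obtain ⟨u, hu, hus, huc⟩ := hswap _ (hsub b hb hab)
  obtain ⟨v, hv, hvs, hvc⟩ := hswap _ (hsub d hd had)
  have hpres : ∀ s : Perm Ω, s.support ⊆ c.supportᶜ → ∀ x, x ∉ c.support → s x ∉ c.support := by
    intro s hs x hx
    by_cases h : s x = x
    · rwa [h]
    · exact Finset.mem_compl.1 (hs (apply_mem_support.2 (mem_support.2 h)))
  have hfix : ∀ s : Perm Ω, s.support ⊆ c.supportᶜ → ∀ x ∈ c.support, s x = x := by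
    intro s hs x hx
    by_contra h
    exact Finset.mem_compl.1 (hs (mem_support.2 h)) hx
  set s₁ := swap a b
  set s₂ := swap a d
  have hs₁ : s₁.support ⊆ c.supportᶜ := hsub b hb hab
  have hs₂ : s₂.support ⊆ c.supportᶜ := hsub d hd had
  have hwcomm := commute_of_conj_mem_zpowers huc hvc
  -- On the fixed points of `c`, the elements `u` and `v` act as `s₁` and `s₂`, so `w` acts there as
  -- the commutator of two transpositions sharing a point, a 3-cycle.
  obtain ⟨w, hw⟩ : ∃ w, w = (v * u)⁻¹ * (u * v) := ⟨_, rfl⟩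
  rw [← hw] at hwcomm
  have hwG : w ∈ G := hw ▸ mul_mem (inv_mem (mul_mem hv hu)) (mul_mem hu hv)
  have ht : (s₁ * s₂ * (s₁ * s₂)).IsThreeCycle :=
    (isThreeCycle_swap_mul_swap_same hab had hbd).isThreeCycle_sq
  obtain ⟨t, ht'⟩ : ∃ t, t = s₁ * s₂ * (s₁ * s₂) := ⟨_, rfl⟩
  rw [← ht'] at ht
  have hwt : ∀ x, x ∉ c.support → w x = t x := by
    intro x hx
    have h1 := hpres _ hs₂ x hx
    have h2 := hpres _ hs₁ _ h1
    have h3 := hpres _ hs₂ _ h2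
    rw [hw, Perm.mul_apply, Perm.inv_eq_iff_eq]
    simp only [ht', Perm.mul_apply]
    rw [hvs x hx, hus _ h1, hus _ (hpres _ hs₁ _ h3), hvs]
    · simp [s₁, s₂]
    · simpa [s₁] using h3
  have htsupp : ∀ x, x ∉ c.support → t x ∉ c.support := fun x hx => ht' ▸
    hpres _ hs₁ _ (hpres _ hs₂ _ (hpres _ hs₁ _ (hpres _ hs₂ _ hx)))
  have htfix : ∀ x ∈ c.support, t x = x := by
    intro x hx
    simp only [ht', Perm.mul_apply, hfix _ hs₁ x hx, hfix _ hs₂ x hx]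
  -- On its support, a cycle is centralized only by its own powers.
  obtain ⟨hwc, hwz⟩ := hc.commute_iff.1 hwcomm
  obtain ⟨m, hm⟩ := Subgroup.mem_zpowers_iff.1 hwz
  have hwm : ∀ x ∈ c.support, w x = (c ^ m) x := by
    intro x hx
    rw [hm, ofSubtype_apply_of_mem _ hx]
    rfl
  -- The `q`-th power kills the part of `w` on `c.support`, a power of `c`, and leaves a 3-cycle
  -- because `3 ∤ q`.
  have hkey : w ^ q = t ^ q := by
    ext x
    by_cases hx : x ∈ c.support
    · have h1 : ∀ n : ℕ, (w ^ n) x = ((c ^ m) ^ n) x ∧ (w ^ n) x ∈ c.support := by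
        intro n
        induction n with
        | zero => exact ⟨rfl, hx⟩
        | succ n ih =>
          rw [pow_succ', pow_succ', Perm.mul_apply, Perm.mul_apply]
          refine ⟨by rw [hwm _ ih.2, ih.1], ?_⟩
          rw [hwm _ ih.2]
          exact zpow_apply_mem_support.2 ih.2
      have h2 : ∀ n : ℕ, (t ^ n) x = x := by
        intro n
        induction n with
        | zero => rfl
        | succ n ih => rw [pow_succ, Perm.mul_apply, htfix x hx, ih]
      rw [(h1 q).1, h2, ← zpow_natCast, ← zpow_mul, mul_comm, zpow_mul, zpow_natCast, ← hcq,
        ← hc.orderOf, pow_orderOf_eq_one, one_zpow, Perm.one_apply]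
    · have h1 : ∀ n : ℕ, (w ^ n) x = (t ^ n) x ∧ (t ^ n) x ∉ c.support := by
        intro n
        induction n with
        | zero => exact ⟨rfl, hx⟩
        | succ n ih =>
          rw [pow_succ', pow_succ', Perm.mul_apply, Perm.mul_apply, ih.1]
          exact ⟨hwt _ ih.2, htsupp _ ih.2⟩
      rw [(h1 q).1]
  refine alternatingGroup_le_of_isPreprimitive_of_isThreeCycle_mem hG (g := w ^ q) ?_
    (pow_mem hwG q)
  rw [hkey]
  refine isThreeCycle_pow ht fun h => ?_
  rcases (Nat.dvd_prime hq).1 h with h | h <;> omega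

end Jordan
end HigmanTriangle

namespace HigmanTriangle

open Equiv Equiv.Perm MulAction
open scoped Pointwise

/-! ### Primitivity from a cycle of prime length -/

section Generation

variable {Ω : Type*}

/-- `X` and `Y` connect any two points. -/
def Connects (X Y : Perm Ω) : Prop :=
  ∀ R : Ω → Ω → Prop, Equivalence R → (∀ v, R v (X v)) → (∀ v, R v (Y v)) → ∀ u v, R u v

theorem Connects.isPretransitive {X Y : Perm Ω} (h : Connects X Y) :
    IsPretransitive (Subgroup.closure {X, Y}) Ω := by
  have key : ∀ u v : Ω, v ∈ orbit (Subgroup.closure {X, Y}) u := by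
    refine h _ ⟨fun u => mem_orbit_self u, fun huv => mem_orbit_symm.1 huv,
      fun huv hvw => ?_⟩ (fun v => ?_) (fun v => ?_)
    · rw [← orbit_eq_iff] at *
      rw [hvw, huv]
    · exact ⟨⟨X, Subgroup.subset_closure (by simp)⟩, rfl⟩
    · exact ⟨⟨Y, Subgroup.subset_closure (by simp)⟩, rfl⟩
  exact ⟨fun u v => key u v⟩

variable [Fintype Ω] [DecidableEq Ω]

/-- Let `B` be a block through `i`. If `c` fixes `B`, then `B` contains `c.support`, so `i`, `X i`
and `j`, `Y j` show that both generators fix `B`, and `B` is everything. Otherwise `B` contains no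
fixed point of `c`, and two points of `B` would differ by a power of `c` fixing `B`; as `q` is
prime, a nontrivial such power generates `c`. -/
theorem isPreprimitive_closure {X Y c : Perm Ω} (h : Connects X Y) {q : ℕ} (hq : q.Prime)
    (hc : c.IsCycle) (hcq : c.support.card = q) (hcG : c ∈ Subgroup.closure {X, Y})
    {i j : Ω} (hi : i ∈ c.support) (hXi : X i ∈ c.support) (hj : j ∈ c.support)
    (hYj : Y j ∈ c.support) : IsPreprimitive (Subgroup.closure {X, Y}) Ω := by
  have htrans := h.isPretransitive
  refine IsPreprimitive.of_isTrivialBlock_base i fun {B} hiB hB => ?_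
  have hinv : ∀ g : Subgroup.closure {X, Y}, ∀ a ∈ B, (g : Perm Ω) a ∈ B → g • B = B :=
    fun g a ha hga => isBlock_iff_smul_eq_of_mem.1 hB ha hga
  let c' : Subgroup.closure {X, Y} := ⟨c, hcG⟩
  by_cases hcB : c' • B = B
  · right
    have hpow : ∀ n : ℤ, (c' ^ n) • B = B := fun n =>
      (zpow_mem (show c' ∈ stabilizer _ B from hcB) n :)
    have hsupp : ∀ a ∈ c.support, a ∈ B := by
      intro a ha
      obtain ⟨n, hn⟩ := hc.exists_zpow_eq (mem_support.1 hi) (mem_support.1 ha)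
      rw [← hpow n, ← hn]
      exact Set.smul_mem_smul_set (a := c' ^ n) hiB
    have hstab : Subgroup.closure {X, Y} ≤ stabilizer (Perm Ω) B := by
      rw [Subgroup.closure_le]
      rintro g (rfl | rfl)
      · exact hinv ⟨_, Subgroup.subset_closure (by simp)⟩ i hiB (hsupp _ hXi)
      · exact hinv ⟨_, Subgroup.subset_closure (by simp)⟩ j (hsupp _ hj) (hsupp _ hYj)
    refine Set.eq_univ_of_forall fun v => ?_
    obtain ⟨g, rfl⟩ := exists_smul_eq (Subgroup.closure {X, Y}) i v
    rw [← show (g : Perm Ω) • B = B from hstab g.2]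
    exact Set.smul_mem_smul_set hiB
  · left
    have hsub : B ⊆ c.support := by
      intro a ha
      refine mem_support.2 fun hca => hcB (hinv c' a ha ?_)
      rwa [show (c' : Perm Ω) a = a from hca]
    intro a ha b hb
    obtain ⟨n, hn⟩ := hc.exists_pow_eq (mem_support.1 (hsub ha)) (mem_support.1 (hsub hb))
    have hn' : c' ^ n • B = B := hinv (c' ^ n) a ha (by
      rw [← hn] at hb; simpa [c'] using hb)
    by_cases hnq : q ∣ n
    · rw [← hn]
      rw [← hcq, ← hc.orderOf, orderOf_dvd_iff_pow_eq_one] at hnq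
      rw [hnq, Perm.one_apply]
    · exfalso
      have hcop : n.Coprime (orderOf c') := by
        rw [Subgroup.orderOf_mk, hc.orderOf, hcq]
        exact ((Nat.Prime.coprime_iff_not_dvd hq).2 hnq).symm
      obtain ⟨m, hm⟩ := exists_pow_eq_self_of_coprime hcop
      apply hcB
      rw [← hm]
      exact (pow_mem (show c' ^ n ∈ stabilizer _ B from hn') m :)

end Generation
end HigmanTriangle

namespace HigmanTriangle

open Equiv Equiv.Perm MulAction

/-! ### Joining handles -/

section Join

theorem viaEmbedding_mul {S W : Type*} (σ τ : Perm S) (e : S ↪ W) :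
    σ.viaEmbedding e * τ.viaEmbedding e = (σ * τ).viaEmbedding e := by
  simp only [← viaEmbeddingHom_apply, map_mul]

theorem viaEmbedding_one {S W : Type*} (e : S ↪ W) : (1 : Perm S).viaEmbedding e = 1 := by
  simp only [← viaEmbeddingHom_apply, map_one]

variable {W S : Type*} {X Y : Perm W} {a b : S ↪ W} (ρ : Perm S)

theorem viaEmbedding_pow (e : S ↪ W) (n : ℕ) :
    ρ.viaEmbedding e ^ n = (ρ ^ n).viaEmbedding e := by
  simp only [← viaEmbeddingHom_apply, map_pow]

theorem viaEmbedding_inv (e : S ↪ W) : (ρ.viaEmbedding e)⁻¹ = (ρ⁻¹).viaEmbedding e := by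
  simp only [← viaEmbeddingHom_apply, map_inv]

/-- Conjugation by `Z` transports the copy of `ρ` along `e` to the copy along `e'`. With `e = e'` it
gives commutation with `X`, and with `Z = Y` it turns `a`-copies into `b`-copies. -/
theorem mul_viaEmbedding_of_comm {e e' : S ↪ W} {Z : Perm W} (h : ∀ s, Z (e s) = e' s) :
    Z * ρ.viaEmbedding e = ρ.viaEmbedding e' * Z := by
  ext v
  simp only [Perm.mul_apply]
  by_cases hv : v ∈ Set.range e
  · obtain ⟨s, rfl⟩ := hv
    rw [viaEmbedding_apply, h, h, viaEmbedding_apply]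
  · rw [viaEmbedding_apply_of_notMem _ _ _ hv, viaEmbedding_apply_of_notMem]
    rintro ⟨s, hs⟩
    exact hv ⟨s, Z.injective ((h s).trans hs)⟩

theorem commute_viaEmbedding (hab : ∀ s s', a s ≠ b s') :
    Commute (ρ.viaEmbedding a) (ρ.viaEmbedding b) :=
  mul_viaEmbedding_of_comm ρ fun s =>
    viaEmbedding_apply_of_notMem _ _ _ fun ⟨s', hs'⟩ => hab s' s hs'

/-- The permutation `X` of a diagram, with the loops at the points of the handles `(a s, b s)`
replaced by cycles: the points `a s` are permuted by `ρ` and the points `b s` by `ρ⁻¹`. -/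
noncomputable def joinX (X : Perm W) (a b : S ↪ W) (ρ : Perm S) : Perm W :=
  ρ.viaEmbedding a * (ρ.viaEmbedding b)⁻¹ * X

variable (hXa : ∀ s, X (a s) = a s) (hXb : ∀ s, X (b s) = b s) (hY : ∀ s, Y (a s) = b s)
  (hab : ∀ s s', a s ≠ b s')

include hXa hab in
theorem joinX_apply_left (s : S) : joinX X a b ρ (a s) = a (ρ s) := by
  rw [joinX, Perm.mul_apply, Perm.mul_apply, hXa, viaEmbedding_inv,
    viaEmbedding_apply_of_notMem _ b, viaEmbedding_apply]
  rintro ⟨s', hs'⟩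
  exact hab _ _ hs'.symm

include hXa hXb in
theorem joinX_apply_of_notMem {v : W} (ha : v ∉ Set.range a) (hb : v ∉ Set.range b) :
    joinX X a b ρ v = X v := by
  rw [joinX, Perm.mul_apply, Perm.mul_apply, viaEmbedding_inv, viaEmbedding_apply_of_notMem _ b,
    viaEmbedding_apply_of_notMem _ a]
  · rintro ⟨s, hs⟩
    exact ha ⟨s, X.injective ((hXa s).trans hs)⟩
  · rintro ⟨s, hs⟩
    exact hb ⟨s, X.injective ((hXb s).trans hs)⟩

include hXa hXb hab in
-- The three factors of `joinX` commute, since `X` fixes all the points that the other two move.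
theorem joinX_pow {p : ℕ} (hX : X ^ p = 1) (hρ : ρ ^ p = 1) : joinX X a b ρ ^ p = 1 := by
  have h1 : Commute X (ρ.viaEmbedding a) := mul_viaEmbedding_of_comm ρ hXa
  have h2 : Commute X (ρ.viaEmbedding b) := mul_viaEmbedding_of_comm ρ hXb
  have h3 := commute_viaEmbedding ρ hab
  rw [joinX, ((h1.mul_right h2.inv_right).symm).mul_pow, h3.inv_right.mul_pow, hX, inv_pow,
    viaEmbedding_pow, viaEmbedding_pow, hρ]
  simp [← viaEmbeddingHom_apply]

include hXb hY in
-- Moving `Y` past the `a`-copy of `ρ` turns it into the `b`-copy, and the inverse `b`-copy commutes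
-- with `X`.
theorem mul_joinX : Y * joinX X a b ρ = ρ.viaEmbedding b * (Y * X) * (ρ.viaEmbedding b)⁻¹ := by
  have h2 : Commute X (ρ.viaEmbedding b) := mul_viaEmbedding_of_comm ρ hXb
  have h3 := mul_viaEmbedding_of_comm ρ hY
  rw [joinX, mul_assoc _ _ X, ← h2.inv_right.eq, ← mul_assoc, h3]
  simp only [mul_assoc]

include hXa hXb hY hab in
theorem mul_joinX_inv : Y * (joinX X a b ρ)⁻¹ =
    (ρ.viaEmbedding b)⁻¹ * (Y * X⁻¹) * ((ρ.viaEmbedding b)⁻¹)⁻¹ := by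
  have h1 : Commute X (ρ.viaEmbedding a) := mul_viaEmbedding_of_comm ρ hXa
  have h2 : Commute X (ρ.viaEmbedding b) := mul_viaEmbedding_of_comm ρ hXb
  have h3 : Y * (ρ.viaEmbedding a)⁻¹ = (ρ.viaEmbedding b)⁻¹ * Y := by
    rw [viaEmbedding_inv, viaEmbedding_inv]
    exact mul_viaEmbedding_of_comm _ hY
  have h4 := commute_viaEmbedding ρ hab
  have h5 : joinX X a b ρ = X * (ρ.viaEmbedding b)⁻¹ * ρ.viaEmbedding a := by
    rw [joinX, h4.inv_right.eq, ← (h2.inv_right.mul_right h1).eq, mul_assoc]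
  rw [h5, mul_inv_rev, mul_inv_rev, ← mul_assoc, h3, inv_inv, ← h2.inv_left.eq]
  simp only [mul_assoc]

include hXa hXb hab in
/-- The joined diagram connects the points that the original diagram connects, and the handles in
an orbit of `ρ`. -/
theorem connects_joinX (h : ∀ R : W → W → Prop, Equivalence R →
      (∀ v, R v (X v)) → (∀ v, R v (Y v)) → (∀ s, R (a s) (a (ρ s))) → ∀ u v, R u v) :
    Connects (joinX X a b ρ) Y := by
  intro R hR hX hY
  refine h R hR (fun v => ?_) hY fun s => ?_
  · by_cases ha : v ∈ Set.range a
    · obtain ⟨s, rfl⟩ := ha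
      rw [hXa]; exact hR.refl _
    by_cases hb : v ∈ Set.range b
    · obtain ⟨s, rfl⟩ := hb
      rw [hXb]; exact hR.refl _
    rw [← joinX_apply_of_notMem ρ hXa hXb ha hb]
    exact hX v
  · rw [← joinX_apply_left ρ hXa hab]
    exact hX _

end Join

/-! ### Arranging the handles in rows -/

section Arrangement

open scoped Fin.NatCast Fin.CommRing

/-- Place the handles of `N + 1` pieces, of which the first has one and each other one two, in
rows of `p`, so that the rows connect the pieces: the handle `(k, false)` of piece `k` leads to
the handles `(j, true)` of its descendants `j` in the tree where the children of `k` are the `p - 1`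
pieces after `k * (p - 1)`; the last row is filled up with further handles `(j, false)`. -/
theorem exists_arrangement {p N : ℕ} (hp : 3 ≤ p) (hN : 2 * p ≤ N) :
    ∃ (m : ℕ) (f : Fin m × Fin p → Fin (N + 1) × Bool), Function.Injective f ∧
      (∀ s, f s ≠ (0, true)) ∧
      ∀ R : Fin (N + 1) → Fin (N + 1) → Prop, Equivalence R →
        (∀ k s s', R (f (k, s)).1 (f (k, s')).1) → ∀ i j, R i j := by
  obtain ⟨d, rfl⟩ : ∃ d, p = d + 1 := ⟨p - 1, by omega⟩
  -- There are `m + 1` rows, numbered from `0` to `m`, and only row `m` can overrun piece `N`. The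
  -- bound `2 * p ≤ N` leaves `d` pieces after piece `m` whose `false` handles are free to fill it.
  set m := N / d with hm
  have hd : 0 < d := by omega
  have hmN : m + d ≤ N := by
    have : m ≤ N / 2 := Nat.div_le_div_left (by omega) (by omega)
    omega
  have hNlt : N < m * d + d := by
    have := Nat.lt_div_mul_add hd (a := N)
    rwa [← hm] at this
  have hjm : ∀ k s : ℕ, k ≤ m → s ≤ d → k * d + s ≤ m * d + d := fun k s hk hs =>
    Nat.add_le_add (Nat.mul_le_mul_right d hk) hs
  have hmd : m * d ≤ N := Nat.div_mul_le_self N d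
  let g : ℕ → ℕ → ℕ × Bool := fun k s =>
    if s = 0 then (k, false) else if k * d + s ≤ N then (k * d + s, true)
      else (m + (k * d + s - N), false)
  have hg : ∀ k s : ℕ, k ≤ m → s ≤ d → (g k s).1 < N + 1 := by
    intro k s hk hs
    have := hjm k s hk hs
    simp only [g]
    split_ifs <;> simp only <;> omega
  have hinj : ∀ k s k' s' : ℕ, 0 < s → s ≤ d → 0 < s' → s' ≤ d →
      k * d + s = k' * d + s' → k = k' ∧ s = s' := by
    intro k s k' s' hs0 hs hs0' hs' h
    have h1 : (k * d + (s - 1)) / d = (k' * d + (s' - 1)) / d := by congr 1; omega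
    rw [mul_comm k, mul_comm k', Nat.mul_add_div hd, Nat.mul_add_div hd,
      Nat.div_eq_of_lt (by omega), Nat.div_eq_of_lt (by omega)] at h1
    simp only [add_zero] at h1
    subst h1
    exact ⟨rfl, by omega⟩
  refine ⟨m + 1, fun ks => (⟨(g ks.1 ks.2).1, hg _ _ (by omega) (by omega)⟩, (g ks.1 ks.2).2),
    ?_, ?_, ?_⟩
  · rintro ⟨⟨k, hk⟩, ⟨s, hs⟩⟩ ⟨⟨k', hk'⟩, ⟨s', hs'⟩⟩ h
    have h1 := hjm k s (by omega) (by omega)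
    have h2 := hjm k' s' (by omega) (by omega)
    have h3 := hinj k s k' s'
    simp only [Prod.mk.injEq, Fin.mk.injEq] at h ⊢
    simp only [g] at h
    split_ifs at h <;> simp at h <;> omega
  · rintro ⟨⟨k, hk⟩, ⟨s, hs⟩⟩ h
    simp only [Prod.mk.injEq, Fin.ext_iff, g] at h
    split_ifs at h <;> simp at h
    omega
  · intro R hR hrow
    have h0 : ∀ j (hj : j < N + 1), R 0 ⟨j, hj⟩ := by
      intro j
      induction j using Nat.strong_induction_on with
      | _ j ih =>
        intro hj
        rcases Nat.eq_zero_or_pos j with rfl | hj0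
        · exact hR.refl _
        -- The parent of piece `j` in the tree is `(j - 1) / d`; the remainder gives its column,
        -- shifted by one because column `0` holds the parent.
        have hk : (j - 1) / d < j := (Nat.div_le_self _ _).trans_lt (by omega)
        have hkm : (j - 1) / d ≤ m := Nat.div_le_div_right (by omega)
        have hs : (j - 1) % d < d := Nat.mod_lt _ hd
        have hj' : (j - 1) / d * d + ((j - 1) % d + 1) = j := by
          have := Nat.div_add_mod' (j - 1) d
          omega
        have h1 := hrow ⟨(j - 1) / d, by omega⟩ ⟨0, by omega⟩ ⟨(j - 1) % d + 1, by omega⟩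
        have h2 := ih _ hk (by omega)
        refine hR.trans h2 ?_
        have e1 : (g ((j - 1) / d) 0).1 = (j - 1) / d := by simp [g]
        have e2 : (g ((j - 1) / d) ((j - 1) % d + 1)).1 = j := by
          simp only [g]
          rw [if_neg (by omega), if_pos (by omega)]
          exact hj'
        simpa only [e1, e2] using h1
    exact fun i j => hR.trans (hR.symm (h0 i i.2)) (h0 j j.2)

/-- The rotation of each row of a table with `p` columns. -/
def rowRotation (m p : ℕ) [NeZero p] : Perm (Fin m × Fin p) :=
  Equiv.prodCongr (Equiv.refl _) (Equiv.addRight 1)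

theorem rowRotation_pow_apply (m p : ℕ) [NeZero p] (n : ℕ) (k : Fin m) (s : Fin p) :
    (rowRotation m p ^ n) (k, s) = (k, s + n) := by
  induction n with
  | zero => simp
  | succ n ih =>
    rw [pow_succ', Perm.mul_apply, ih]
    simp [rowRotation, add_assoc]

theorem rowRotation_pow (m p : ℕ) [NeZero p] : rowRotation m p ^ p = 1 := by
  ext1 ⟨k, s⟩
  simp [rowRotation_pow_apply]

theorem rel_row_of_rel_rowRotation {m p : ℕ} [NeZero p] {R : Fin m × Fin p → Fin m × Fin p → Prop}
    (hR : Equivalence R) (h : ∀ s, R s (rowRotation m p s)) (k : Fin m) (s s' : Fin p) :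
    R (k, s) (k, s') := by
  have h1 : ∀ n : ℕ, R (k, 0) ((rowRotation m p ^ n) (k, 0)) := by
    intro n
    induction n with
    | zero => exact hR.refl _
    | succ n ih =>
      rw [pow_succ', Perm.mul_apply]
      exact hR.trans ih (h _)
  have h2 : ∀ t : Fin p, R (k, 0) (k, t) := by
    intro t
    have := h1 t
    rwa [rowRotation_pow_apply, zero_add, Fin.cast_val_eq_self] at this
  exact hR.trans (hR.symm (h2 s)) (h2 s')

end Arrangement
end HigmanTriangle

/-! ### Composing a family of pieces -/

namespace HigmanTriangle

open Equiv.Perm MulAction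
open Equiv (Perm)

/-- A connected diagram on the vertices `Fin size` with two marked pairs of points. -/
structure Piece (p q r : ℕ) where
  size : ℕ
  x : Perm (Fin size)
  y : Perm (Fin size)
  x_pow : x ^ p = 1
  y_pow : y ^ q = 1
  xy_pow : (y * x) ^ r = 1
  connects : Connects x y
  a : Bool → Fin size
  b : Bool → Fin size

namespace Piece

variable {p q r : ℕ}

/-- The marked pair with index `e` has the loops and the arc of a handle. -/
def HandleAt (P : Piece p q r) (e : Bool) : Prop :=
  P.x (P.a e) = P.a e ∧ P.x (P.b e) = P.b e ∧ P.y (P.a e) = P.b e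

/-- The marked pairs are disjoint handles. -/
def HasTwoHandles (P : Piece p q r) : Prop :=
  (∀ e, P.HandleAt e) ∧ Function.Injective P.a ∧ ∀ e e', P.a e ≠ P.b e'

end Piece

theorem sigmaCongrRight_pow {ι : Type*} {V : ι → Type*} (F : ∀ i, Perm (V i)) (n : ℕ) :
    (sigmaCongrRight F) ^ n = sigmaCongrRight fun i => F i ^ n :=
  (map_pow (sigmaCongrRightHom V) F n).symm

theorem sigmaCongrRight_eq_one {ι : Type*} {V : ι → Type*} {F : ∀ i, Perm (V i)}
    (h : ∀ i, F i = 1) : sigmaCongrRight F = 1 := by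
  rw [show F = 1 from funext h, sigmaCongrRight_one]

theorem sigmaCongrRight_eq_viaEmbedding {ι : Type*} {V : ι → Type*} {F : ∀ i, Perm (V i)}
    {i₀ : ι} (h : ∀ i, i ≠ i₀ → F i = 1) :
    sigmaCongrRight F = (F i₀).viaEmbedding (Function.Embedding.sigmaMk i₀) := by
  ext1 ⟨i, v⟩
  by_cases hi : i = i₀
  · subst hi
    exact (viaEmbedding_apply (F i) (Function.Embedding.sigmaMk i) v).symm
  · rw [viaEmbedding_apply_of_notMem]
    · simp [h i hi]
    · rintro ⟨w, hw⟩
      exact hi (congrArg Sigma.fst hw).symm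

theorem isCycle_viaEmbedding {S W : Type*} {σ : Perm S} (h : σ.IsCycle) (e : S ↪ W) :
    (σ.viaEmbedding e).IsCycle := by
  classical
  exact h.extendDomain _

theorem card_support_viaEmbedding {S W : Type*} [Fintype S] [DecidableEq S] [Fintype W]
    [DecidableEq W] (σ : Perm S) (e : S ↪ W) :
    (σ.viaEmbedding e).support.card = σ.support.card := by
  have : (σ.viaEmbedding e).support = σ.support.map e := by
    ext w
    simp only [mem_support, Finset.mem_map]
    constructor
    · intro hw
      by_cases h : w ∈ Set.range e
      · obtain ⟨s, rfl⟩ := h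
        rw [viaEmbedding_apply, e.injective.ne_iff] at hw
        exact ⟨s, hw, rfl⟩
      · exact absurd (viaEmbedding_apply_of_notMem _ _ _ h) hw
    · rintro ⟨s, hs, rfl⟩
      rwa [viaEmbedding_apply, e.injective.ne_iff]
  rw [this, Finset.card_map]

section Compose

variable {p q r N : ℕ} (P : Fin (N + 1) → Piece p q r)

/-- On the disjoint union, the `M`-th power of `Y * X⁻¹` is a `q`-cycle inside piece `0`. Joining
only conjugates it by a permutation of the points `b s`, so it still moves `s`, `t` and their
images, as primitivity and Jordan's theorem require. -/
theorem exists_generating_pair (hq : q.Prime) (hp3 : 3 ≤ p) (hpq : p < q) (hN : 2 * p ≤ N)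
    (h0 : (P 0).HandleAt false) (h0' : (P 0).a false ≠ (P 0).b false)
    (hP : ∀ i, i ≠ 0 → (P i).HasTwoHandles) {M : ℕ}
    (hM : ∀ i, i ≠ 0 → ((P i).y * (P i).x⁻¹) ^ M = 1)
    (hc : (((P 0).y * (P 0).x⁻¹) ^ M).IsCycle)
    (hcq : (((P 0).y * (P 0).x⁻¹) ^ M).support.card = q) (hcard : q + 3 ≤ (P 0).size)
    {s t : Fin (P 0).size} (hs : s ∈ (((P 0).y * (P 0).x⁻¹) ^ M).support)
    (hxs : (P 0).x s ∈ (((P 0).y * (P 0).x⁻¹) ^ M).support)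
    (ht : t ∈ (((P 0).y * (P 0).x⁻¹) ^ M).support)
    (hyt : (P 0).y t ∈ (((P 0).y * (P 0).x⁻¹) ^ M).support)
    (hsa : s ≠ (P 0).a false) (hsb : s ≠ (P 0).b false)
    (hta : t ≠ (P 0).a false) (htb : t ≠ (P 0).b false) :
    ∃ X Y : Perm (Σ i, Fin (P i).size), X ^ p = 1 ∧ Y ^ q = 1 ∧ (Y * X) ^ r = 1 ∧
      alternatingGroup (Σ i, Fin (P i).size) ≤ Subgroup.closure {X, Y} := by
  have : NeZero p := ⟨by omega⟩
  obtain ⟨m, f, hf, hft, hconn⟩ := exists_arrangement hp3 hN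
  -- Piece `0` is only asked for the handle with index `false`; the arrangement avoids `(0, true)`.
  have hvalid : ∀ (i : Fin (N + 1)) (e : Bool), (i, e) ≠ (0, true) → (P i).HandleAt e ∧
      ∀ e', (i, e') ≠ (0, true) → ((P i).a e = (P i).a e' → e = e') ∧ (P i).a e ≠ (P i).b e' := by
    intro i e he
    by_cases hi : i = 0
    · subst hi
      have hee : ∀ e : Bool, ((0 : Fin (N + 1)), e) ≠ (0, true) → e = false := by
        intro e he
        cases e
        · rfl
        · exact absurd rfl he
      rw [hee e he]
      refine ⟨h0, fun e' he' => ?_⟩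
      rw [hee e' he']
      exact ⟨fun _ => rfl, h0'⟩
    · obtain ⟨h1, h2, h3⟩ := hP i hi
      exact ⟨h1 e, fun e' _ => ⟨fun h => h2 h, h3 e e'⟩⟩
  let a₀ : Fin (N + 1) × Bool → Σ i, Fin (P i).size := fun ie => ⟨ie.1, (P ie.1).a ie.2⟩
  let b₀ : Fin (N + 1) × Bool → Σ i, Fin (P i).size := fun ie => ⟨ie.1, (P ie.1).b ie.2⟩
  set X₀ : Perm (Σ i, Fin (P i).size) := sigmaCongrRight fun i => (P i).x with hX₀
  set Y₀ : Perm (Σ i, Fin (P i).size) := sigmaCongrRight fun i => (P i).y with hY₀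
  have hY₀a : ∀ s, Y₀ (a₀ (f s)) = b₀ (f s) := fun s =>
    congrArg (Sigma.mk (β := fun i => Fin (P i).size) _) (hvalid _ _ (hft s)).1.2.2
  have ha₀ : Function.Injective fun s => a₀ (f s) := by
    intro s s' h
    apply hf
    have h1 := hft s
    have h2 := hft s'
    have h : a₀ (f s) = a₀ (f s') := h
    generalize f s = ie at *
    generalize f s' = ie' at *
    obtain ⟨i, e⟩ := ie
    obtain ⟨i', e'⟩ := ie'
    obtain rfl : i = i' := congrArg Sigma.fst h
    rw [((hvalid i e h1).2 e' h2).1 (sigma_mk_injective (β := fun i => Fin (P i).size) h)]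
  have hb₀ : Function.Injective fun s => b₀ (f s) := by
    intro s s' h
    simp only [← hY₀a] at h
    exact ha₀ (Y₀.injective h)
  let a : Fin m × Fin p ↪ Σ i, Fin (P i).size := ⟨_, ha₀⟩
  let b : Fin m × Fin p ↪ Σ i, Fin (P i).size := ⟨_, hb₀⟩
  have hXa : ∀ s, X₀ (a s) = a s := fun s => congrArg (Sigma.mk (β := fun i => Fin (P i).size) _) (hvalid _ _ (hft s)).1.1
  have hXb : ∀ s, X₀ (b s) = b s := fun s => congrArg (Sigma.mk (β := fun i => Fin (P i).size) _) (hvalid _ _ (hft s)).1.2.1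
  have hYa : ∀ s, Y₀ (a s) = b s := hY₀a
  have hab : ∀ s s', a s ≠ b s' := by
    intro s s' h
    have h1 := hft s
    have h2 := hft s'
    have h : a₀ (f s) = b₀ (f s') := h
    generalize f s = ie at *
    generalize f s' = ie' at *
    obtain ⟨i, e⟩ := ie
    obtain ⟨i', e'⟩ := ie'
    obtain rfl : i = i' := congrArg Sigma.fst h
    exact ((hvalid i e h1).2 e' h2).2 (sigma_mk_injective (β := fun i => Fin (P i).size) h)
  have hrange : ∀ z : Fin (P 0).size, z ≠ (P 0).b false →
      (⟨0, z⟩ : Σ i, Fin (P i).size) ∉ Set.range b := by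
    rintro z hz ⟨s, hs⟩
    have h1 := hft s
    have hs : b₀ (f s) = ⟨0, z⟩ := hs
    generalize f s = ie at *
    obtain ⟨i, e⟩ := ie
    obtain rfl : i = 0 := congrArg Sigma.fst hs
    cases e
    · exact hz (sigma_mk_injective hs).symm
    · exact h1 rfl
  have hrange' : ∀ z : Fin (P 0).size, z ≠ (P 0).a false →
      (⟨0, z⟩ : Σ i, Fin (P i).size) ∉ Set.range a := by
    rintro z hz ⟨s, hs⟩
    have h1 := hft s
    have hs : a₀ (f s) = ⟨0, z⟩ := hs
    generalize f s = ie at *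
    obtain ⟨i, e⟩ := ie
    obtain rfl : i = 0 := congrArg Sigma.fst hs
    cases e
    · exact hz (sigma_mk_injective hs).symm
    · exact h1 rfl
  set ρ := rowRotation m p with hρ
  set X := joinX X₀ a b ρ with hX
  have hconnects : Connects X Y₀ := by
    refine connects_joinX ρ hXa hXb hab fun R hR hRX hRY hRρ => ?_
    have hpiece : ∀ i u v, R ⟨i, u⟩ ⟨i, v⟩ := fun i =>
      (P i).connects (fun u v => R ⟨i, u⟩ ⟨i, v⟩)
        ⟨fun _ => hR.refl _, hR.symm, hR.trans⟩ (fun v => hRX ⟨i, v⟩) (fun v => hRY ⟨i, v⟩)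
    have hrow := rel_row_of_rel_rowRotation (R := fun s s' => R (a s) (a s'))
      ⟨fun _ => hR.refl _, hR.symm, hR.trans⟩ hRρ
    have hpieces := hconn (fun i j => ∀ u v, R ⟨i, u⟩ ⟨j, v⟩)
      ⟨hpiece, fun h u v => hR.symm (h v u),
        fun {i j k} h h' u v => hR.trans (h u ((P j).a false)) (h' _ v)⟩
      (fun k s s' u v => hR.trans (hpiece _ _ _) (hR.trans (hrow k s s') (hpiece _ _ _)))
    rintro ⟨i, u⟩ ⟨j, v⟩
    exact hpieces i j u v
  have hT : (Y₀ * X₀⁻¹) ^ M = (((P 0).y * (P 0).x⁻¹) ^ M).viaEmbedding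
      (Function.Embedding.sigmaMk (β := fun i => Fin (P i).size) (0 : Fin (N + 1))) := by
    rw [hX₀, hY₀, sigmaCongrRight_inv, sigmaCongrRight_mul, sigmaCongrRight_pow]
    exact sigmaCongrRight_eq_viaEmbedding hM
  set C := ρ.viaEmbedding b with hC
  have hcyc : (Y₀ * X⁻¹) ^ M = C⁻¹ * (Y₀ * X₀⁻¹) ^ M * (C⁻¹)⁻¹ := by
    rw [hX, mul_joinX_inv ρ hXa hXb hYa hab, conj_pow]
  -- The conjugating permutation `C` moves only points of the form `b s`, so it fixes every other
  -- point of piece `0`.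
  have hmem : ∀ z : Fin (P 0).size, z ≠ (P 0).b false →
      z ∈ (((P 0).y * (P 0).x⁻¹) ^ M).support →
      (⟨0, z⟩ : Σ i, Fin (P i).size) ∈ ((Y₀ * X⁻¹) ^ M).support := by
    intro z hz hzs
    have hCz : C ⟨0, z⟩ = ⟨0, z⟩ := viaEmbedding_apply_of_notMem _ _ _ (hrange z hz)
    rw [mem_support, hcyc, inv_inv, Perm.mul_apply, Perm.mul_apply, Ne, inv_eq_iff_eq, hCz, hT]
    intro h
    have h' := viaEmbedding_apply (((P 0).y * (P 0).x⁻¹) ^ M)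
      (Function.Embedding.sigmaMk (β := fun i => Fin (P i).size) (0 : Fin (N + 1))) z
    exact (mem_support.1 hzs) (sigma_mk_injective (β := fun i => Fin (P i).size) (h'.symm.trans h))
  have hTcyc : ((Y₀ * X₀⁻¹) ^ M).IsCycle := by
    rw [hT]
    exact isCycle_viaEmbedding hc _
  have hTcard : ((Y₀ * X₀⁻¹) ^ M).support.card = q := by
    rw [hT, card_support_viaEmbedding, hcq]
  have hXs : X ⟨0, s⟩ = ⟨0, (P 0).x s⟩ :=
    joinX_apply_of_notMem ρ hXa hXb (hrange' s hsa) (hrange s hsb)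
  have hcycle : ((Y₀ * X⁻¹) ^ M).IsCycle := hcyc ▸ hTcyc.conj
  have hcycleq : ((Y₀ * X⁻¹) ^ M).support.card = q := by
    rw [hcyc, support_conj, Finset.card_map, hTcard]
  have hXmem : X ∈ Subgroup.closure {X, Y₀} := Subgroup.subset_closure (by simp)
  have hYmem : Y₀ ∈ Subgroup.closure {X, Y₀} := Subgroup.subset_closure (by simp)
  have hcmem : (Y₀ * X⁻¹) ^ M ∈ Subgroup.closure {X, Y₀} :=
    pow_mem (mul_mem hYmem (inv_mem hXmem)) M
  have hprim := isPreprimitive_closure hconnects hq hcycle hcycleq hcmem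
    (i := ⟨0, s⟩) (j := ⟨0, t⟩) (hmem s hsb hs)
    (by
      rw [hXs]
      -- Since `x` fixes the point `b` of the handle, `x s` can equal it only if `s` does; below, `y
      -- t` can equal it only if `t` is the point `a`.
      exact hmem _ (fun h => hsb ((P 0).x.injective (h.trans h0.2.1.symm))) hxs)
    (hmem t htb ht)
    (hmem _ (fun h => hta ((P 0).y.injective (h.trans h0.2.2.symm))) hyt)
  refine ⟨X, Y₀, ?_, ?_, ?_, ?_⟩
  · refine joinX_pow ρ hXa hXb hab ?_ (rowRotation_pow m p)
    rw [hX₀, sigmaCongrRight_pow, sigmaCongrRight_eq_one fun i => (P i).x_pow]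
  · rw [hY₀, sigmaCongrRight_pow, sigmaCongrRight_eq_one fun i => (P i).y_pow]
  · rw [hX, mul_joinX ρ hXb hYa, conj_pow, hX₀, hY₀, sigmaCongrRight_mul, sigmaCongrRight_pow]
    erw [sigmaCongrRight_eq_one fun i => (P i).xy_pow, mul_one]
    exact mul_inv_cancel _
  · refine alternatingGroup_le_of_isPreprimitive_of_isCycle_mem hprim hq (by omega) ?_
      hcycle hcycleq hcmem
    refine hcard.trans ?_
    rw [Nat.card_eq_fintype_card]
    simpa using Fintype.card_le_of_injective _
      (Function.Embedding.sigmaMk (β := fun i => Fin (P i).size) (0 : Fin (N + 1))).injective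

end Compose
end HigmanTriangle

namespace HigmanTriangle

open Equiv.Perm MulAction
open Equiv (Perm)

/-! ### Isolating the `q`-cycle by taking powers -/

section CycleStructure

variable {V : Type*} [Fintype V] [DecidableEq V]

theorem exists_mem_cycleType_of_prime_dvd_orderOf {σ : Perm V} {q : ℕ} (hq : q.Prime)
    (h : q ∣ orderOf σ) : ∃ k, 1 ≤ k ∧ k * q ∈ σ.cycleType := by
  rw [← lcm_cycleType] at h
  have h1 : σ.cycleType.lcm ∣ σ.cycleType.prod :=
    Multiset.lcm_dvd.2 fun n hn => Multiset.dvd_prod hn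
  obtain ⟨n, hn, k, rfl⟩ := hq.prime.exists_mem_multiset_dvd (h.trans h1)
  refine ⟨k, ?_, mul_comm q k ▸ hn⟩
  by_contra hk
  have := two_le_of_mem_cycleType hn
  simp [show k = 0 by omega] at this

/-- The two counts differ only at `1`, because `cycleType` omits fixed points. -/
theorem cycleStructure_eq_count_cycleType (σ : Perm V) {n : ℕ} (hn : n ≠ 1) :
    cycleStructure σ n = σ.cycleType.count n := by
  rw [cycleStructure, parts_partition, Multiset.count_add, Multiset.count_replicate,
    if_neg hn.symm, add_zero]

theorem mul_prime_ne_one {q : ℕ} (hq : q.Prime) (k : ℕ) : k * q ≠ 1 := fun h =>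
  hq.one_lt.ne' (Nat.eq_one_of_mul_eq_one_left h)

theorem not_dvd_orderOf_of_cycleStructure {σ : Perm V} {q : ℕ} (hq : q.Prime)
    (h : ∀ k : ℕ, 1 ≤ k → cycleStructure σ (k * q) = 0) : ¬ q ∣ orderOf σ := by
  intro hdvd
  obtain ⟨k, hk, hmem⟩ := exists_mem_cycleType_of_prime_dvd_orderOf hq hdvd
  have := h k hk
  rw [cycleStructure_eq_count_cycleType _ (mul_prime_ne_one hq k), Multiset.count_eq_zero] at this
  exact this hmem

/-- Take for `m` the order of `σ * μ⁻¹`, which is `σ` with its only `q`-cycle removed. No remaining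
cycle length is a multiple of `q`, so neither is `m`. -/
theorem exists_pow_eq_cycle_pow {σ : Perm V} {q : ℕ} (hq : q.Prime)
    (h : ∀ k : ℕ, 1 ≤ k → cycleStructure σ (k * q) = if k = 1 then 1 else 0) :
    ∃ μ ∈ σ.cycleFactorsFinset, μ.support.card = q ∧
      ∃ m, ¬ q ∣ m ∧ ∀ n, σ ^ (m * n) = μ ^ (m * n) := by
  have hcount : ∀ k : ℕ, 1 ≤ k → σ.cycleType.count (k * q) = if k = 1 then 1 else 0 := by
    intro k hk
    rw [← h k hk, cycleStructure_eq_count_cycleType _ (mul_prime_ne_one hq k)]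
  have hmem : q ∈ σ.cycleType := by
    rw [← Multiset.count_pos]
    have := hcount 1 le_rfl
    rw [one_mul] at this
    simp [this]
  rw [cycleType_def, Multiset.mem_map] at hmem
  obtain ⟨μ, hμ, hμq⟩ := hmem
  have hμ : μ ∈ σ.cycleFactorsFinset := hμ
  have hμq : μ.support.card = q := hμq
  have hcyc : μ.IsCycle := (mem_cycleFactorsFinset_iff.1 hμ).1
  refine ⟨μ, hμ, hμq, orderOf (σ * μ⁻¹), fun hdvd => ?_, fun n => ?_⟩
  · obtain ⟨k, hk, hmem⟩ := exists_mem_cycleType_of_prime_dvd_orderOf hq hdvd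
    rw [cycleType_mul_inv_mem_cycleFactorsFinset_eq_sub hμ, hcyc.cycleType, hμq,
      ← Multiset.count_pos, Multiset.count_sub, hcount k hk] at hmem
    by_cases hk1 : k = 1
    · simp [hk1] at hmem
    · simp [hk1] at hmem
  · have hcomm := (disjoint_mul_inv_of_mem_cycleFactorsFinset hμ).commute
    have h1 := hcomm.mul_pow (orderOf (σ * μ⁻¹) * n)
    rwa [inv_mul_cancel_right, pow_mul (σ * μ⁻¹), pow_orderOf_eq_one, one_pow, one_mul] at h1

end CycleStructure

/-! ### From diagrams to pieces -/

namespace Diagram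

variable {p q r : ℕ} {V : Type*} (K : Diagram p q r V)

theorem theta_genX : K.theta (genX p q r) = K.arcX := by
  simp [theta, thetaHom, genX, PresentedGroup.toGroup.of, arc]

theorem theta_genY : K.theta (genY p q r) = K.arcY := by
  simp [theta, thetaHom, genY, PresentedGroup.toGroup.of, arc]

theorem theta_mul (g h : TriangleGroup p q r) : K.theta (g * h) = K.theta h * K.theta g := by
  simp [theta]

theorem theta_inv (g : TriangleGroup p q r) : K.theta g⁻¹ = (K.theta g)⁻¹ := by
  simp [theta]

theorem theta_genX_inv_mul_genY :
    K.theta ((genX p q r)⁻¹ * genY p q r) = K.arcY * K.arcX⁻¹ := by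
  rw [theta_mul, theta_inv, theta_genX, theta_genY]

variable {K} in
theorem IsHandle.arcY_eq {α β : V} (h : K.IsHandle α β) : K.arcY α = β := by
  have h1 := h.2.2.2
  rwa [theta_mul, theta_genX, theta_genY, Perm.mul_apply, h.2.1] at h1

variable [Fintype V]

/-- An enumeration of the vertices. -/
noncomputable def enum (_ : Diagram p q r V) : V ↪ Fin (Fintype.card V) :=
  (Fintype.equivFin V).toEmbedding

theorem enum_surjective : Function.Surjective K.enum := (Fintype.equivFin V).surjective

theorem connects_enum (hK : K.PathConnected) :
    Connects (K.arcX.viaEmbedding K.enum) (K.arcY.viaEmbedding K.enum) := by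
  intro R hR hX hY u v
  obtain ⟨u, rfl⟩ := K.enum_surjective u
  obtain ⟨v, rfl⟩ := K.enum_surjective v
  induction hK.2 u v with
  | rel u v h =>
    obtain ⟨g, rfl⟩ := h
    cases g
    · have := hX (K.enum u)
      rwa [viaEmbedding_apply] at this
    · have := hY (K.enum u)
      rwa [viaEmbedding_apply] at this
  | refl u => exact hR.refl _
  | symm u v _ ih => exact hR.symm ih
  | trans u v w _ _ ih ih' => exact hR.trans ih ih'

/-- A connected diagram with two marked pairs of points, on the vertices `Fin (card V)`. -/
noncomputable def toPiece (hK : K.PathConnected) (a b : Bool → V) : Piece p q r where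
  size := Fintype.card V
  x := K.arcX.viaEmbedding K.enum
  y := K.arcY.viaEmbedding K.enum
  x_pow := by rw [viaEmbedding_pow, perm_pow_eq_one K.face_x, viaEmbedding_one]
  y_pow := by rw [viaEmbedding_pow, perm_pow_eq_one K.face_y, viaEmbedding_one]
  xy_pow := by
    have h : (K.arcY * K.arcX) ^ r = 1 := perm_pow_eq_one K.face_xy
    rw [viaEmbedding_mul, viaEmbedding_pow, h, viaEmbedding_one]
  connects := K.connects_enum hK
  a e := K.enum (a e)
  b e := K.enum (b e)

variable {K} in
theorem handleAt_toPiece (hK : K.PathConnected) {a b : Bool → V} {e : Bool}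
    (h : K.IsHandle (a e) (b e)) : (K.toPiece hK a b).HandleAt e := by
  refine ⟨?_, ?_, ?_⟩
  · exact (viaEmbedding_apply _ _ _).trans (congrArg _ h.2.1)
  · exact (viaEmbedding_apply _ _ _).trans (congrArg _ h.2.2.1)
  · exact (viaEmbedding_apply _ _ _).trans (congrArg _ h.arcY_eq)

theorem toPiece_mul_inv_pow (hK : K.PathConnected) (a b : Bool → V) (n : ℕ) :
    ((K.toPiece hK a b).y * (K.toPiece hK a b).x⁻¹) ^ n =
      ((K.theta ((genX p q r)⁻¹ * genY p q r)) ^ n).viaEmbedding K.enum := by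
  rw [theta_genX_inv_mul_genY, ← viaEmbedding_pow, ← viaEmbedding_mul, ← viaEmbedding_inv]
  rfl

variable {K} in
theorem HasTwoHandles.exists_piece (h : K.HasTwoHandles) (hK : K.PathConnected) :
    ∃ a b : Bool → V, (K.toPiece hK a b).HasTwoHandles := by
  obtain ⟨α₁, β₁, α₂, β₂, h₁, h₂, h3, h4, h5, -⟩ := h
  refine ⟨fun e => cond e α₂ α₁, fun e => cond e β₂ β₁, fun e => ?_, ?_, ?_⟩
  · apply handleAt_toPiece
    cases e
    · exact h₁
    · exact h₂
  · intro e e' he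
    have := K.enum.injective he
    cases e <;> cases e' <;> simp at this ⊢
    · exact h3 this
    · exact h3 this.symm
  · intro e e' he
    have := K.enum.injective he
    cases e <;> cases e' <;> simp at this
    · exact h₁.1 this
    · exact h4 this
    · exact h5 this.symm
    · exact h₂.1 this

end Diagram

/-! ### Surjections and vertex counts -/

section Surjection

theorem sign_eq_one_of_pow_eq_one {Ω : Type*} [Fintype Ω] [DecidableEq Ω] {σ : Perm Ω} {n : ℕ}
    (hn : Odd n) (h : σ ^ n = 1) : sign σ = 1 := by
  have h1 : sign σ ^ n = 1 := by rw [← map_pow, h, map_one]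
  rcases Int.units_eq_one_or (sign σ) with h2 | h2
  · exact h2
  · rw [h2, hn.neg_one_pow] at h1
    exact absurd h1 (by decide)

theorem exists_surjective_hom {p q r n : ℕ} (hp : Odd p) (hq : Odd q)
    {Ω : Type*} [Fintype Ω] [DecidableEq Ω] (hn : Fintype.card Ω = n) {X Y : Perm Ω}
    (hX : X ^ p = 1) (hY : Y ^ q = 1) (hXY : (Y * X) ^ r = 1)
    (h : alternatingGroup Ω ≤ Subgroup.closure {X, Y}) :
    ∃ f : TriangleGroup p q r →* alternatingGroup (Fin n), Function.Surjective f := by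
  let X' : alternatingGroup Ω := ⟨X, sign_eq_one_of_pow_eq_one hp hX⟩
  let Y' : alternatingGroup Ω := ⟨Y, sign_eq_one_of_pow_eq_one hq hY⟩
  have hX' : X' ^ p = 1 := Subtype.ext hX
  have hY' : Y' ^ q = 1 := Subtype.ext hY
  have hXY' : (X' * Y') ^ r = 1 := by
    have h1 : (Y' * X') ^ r = 1 := Subtype.ext hXY
    -- The relator becomes `X' * Y'`, whereas walks in the diagram give `Y' * X'`; the two are
    -- conjugate.
    rw [show X' * Y' = Y'⁻¹ * (Y' * X') * Y'⁻¹⁻¹ by group, conj_pow, h1, mul_one, mul_inv_cancel]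
  let F : Gen → alternatingGroup Ω := fun g => Gen.casesOn g X' Y'
  have hrel : ∀ w ∈ relators p q r, FreeGroup.lift F w = 1 := by
    rintro w (rfl | rfl | rfl) <;> simpa [F]
  let φ : TriangleGroup p q r →* alternatingGroup Ω := PresentedGroup.toGroup hrel
  have hφ : Function.Surjective φ := by
    intro z
    have hle : Subgroup.closure {X, Y} ≤ ((alternatingGroup Ω).subtype.comp φ).range := by
      rw [Subgroup.closure_le]
      rintro g (rfl | rfl)
      · exact ⟨genX p q r, congrArg Subtype.val (PresentedGroup.toGroup.of hrel (x := Gen.x))⟩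
      · exact ⟨genY p q r, congrArg Subtype.val (PresentedGroup.toGroup.of hrel (x := Gen.y))⟩
    obtain ⟨g, hg⟩ := hle (h z.2)
    exact ⟨g, Subtype.ext hg⟩
  let e := (Fintype.equivFinOfCardEq hn).altCongrHom
  exact ⟨e.toMonoidHom.comp φ, e.surjective.comp hφ⟩

end Surjection

/-- Sylvester's bound gives a representation. It has at least `c` summands, since fewer would add up
to less than `c * (k + l)`. -/
theorem exists_add_eq_of_coprime {k l : ℕ} (hk : 0 < k) (hl : 0 < l) (h : Nat.Coprime k l)
    (c x : ℕ) (hx : k * l + c * (k + l) ≤ x) :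
    ∃ a b : ℕ, a * k + b * l = x ∧ c ≤ a + b := by
  have h1 : k.pred * l.pred ≤ k * l := Nat.mul_le_mul (Nat.pred_le k) (Nat.pred_le l)
  obtain ⟨a, b, hab⟩ := Nat.exists_add_mul_eq_of_gcd_dvd_of_mul_pred_le k l x
    (by rw [h.gcd_eq_one]; exact one_dvd _) (by omega)
  refine ⟨a, b, hab, ?_⟩
  by_contra hlt
  push Not at hlt
  have h2 : (a + b) * (k + l) < c * (k + l) := Nat.mul_lt_mul_of_pos_right hlt (by omega)
  nlinarith

end HigmanTriangle

open HigmanTriangle Equiv.Perm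
theorem mainTheorem2
    {p q r : ℕ} (hp : p.Prime) (hq : q.Prime) (hr : r.Prime)
    (hp3 : 3 ≤ p) (hpq : p < q) (hqr : q < r)
    {V₁ V₂ V₃ : Type*}
    [Fintype V₁] [DecidableEq V₁] [Fintype V₂] [DecidableEq V₂] [Fintype V₃] [DecidableEq V₃]
    (K₁ : HigmanTriangle.Diagram p q r V₁)
    (K₂ : HigmanTriangle.Diagram p q r V₂)
    (K₃ : HigmanTriangle.Diagram p q r V₃)
    (hK₁ : K₁.PathConnected) (hK₂ : K₂.PathConnected) (hK₃ : K₃.PathConnected)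
    (hcop : Nat.Coprime (Fintype.card V₁) (Fintype.card V₂))
    (hcard : q + 3 ≤ Fintype.card V₃)
    (hh₁ : K₁.HasTwoHandles) (hh₂ : K₂.HasTwoHandles)
    (α β : V₃) (hh₃ : K₃.IsHandle α β)
    (hs₁ : ∀ k : ℕ, 1 ≤ k → HigmanTriangle.cycleStructure
      (K₁.theta ((HigmanTriangle.genX p q r)⁻¹ * HigmanTriangle.genY p q r)) (k * q) = 0)
    (hs₂ : ∀ k : ℕ, 1 ≤ k → HigmanTriangle.cycleStructure
      (K₂.theta ((HigmanTriangle.genX p q r)⁻¹ * HigmanTriangle.genY p q r)) (k * q) = 0)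
    (hs₃ : ∀ k : ℕ, 1 ≤ k → HigmanTriangle.cycleStructure
      (K₃.theta ((HigmanTriangle.genX p q r)⁻¹ * HigmanTriangle.genY p q r)) (k * q) =
        if k = 1 then 1 else 0)
    (hμ : ∀ μ ∈ (K₃.theta
        ((HigmanTriangle.genX p q r)⁻¹ * HigmanTriangle.genY p q r)).cycleFactorsFinset,
      μ.support.card = q →
        ∃ i ∈ μ.support, ∃ j ∈ μ.support,
          i ≠ α ∧ i ≠ β ∧ j ≠ α ∧ j ≠ β ∧
          K₃.theta (HigmanTriangle.genX p q r) i ∈ μ.support ∧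
          K₃.theta (HigmanTriangle.genY p q r) j ∈ μ.support) :
    HigmanTriangle.SurjectsAlmostAllAlternating (HigmanTriangle.TriangleGroup p q r) := by
  classical
  obtain ⟨μ, hμT, hμq, m₃, hm₃, hpow₃⟩ := exists_pow_eq_cycle_pow hq hs₃
  have hμc : μ.IsCycle := (mem_cycleFactorsFinset_iff.1 hμT).1
  obtain ⟨i, hi, j, hj, hiα, hiβ, hjα, hjβ, hXi, hYj⟩ := hμ μ hμT hμq
  rw [Diagram.theta_genX] at hXi
  rw [Diagram.theta_genY] at hYj
  set T₁ := K₁.theta ((genX p q r)⁻¹ * genY p q r)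
  set T₂ := K₂.theta ((genX p q r)⁻¹ * genY p q r)
  set T₃ := K₃.theta ((genX p q r)⁻¹ * genY p q r)
  have hm₁ := not_dvd_orderOf_of_cycleStructure hq hs₁
  have hm₂ := not_dvd_orderOf_of_cycleStructure hq hs₂
  -- This exponent kills `T₁` and `T₂` and reduces `T₃` to a power of `μ`; being prime to `q`, it
  -- leaves a `q`-cycle with the same support.
  obtain ⟨M, hM⟩ : ∃ M, M = m₃ * (orderOf T₁ * orderOf T₂) := ⟨_, rfl⟩
  have hMq : M.Coprime (orderOf μ) := by
    rw [hμc.orderOf, hμq, Nat.coprime_comm, hq.coprime_iff_not_dvd, hM, hq.dvd_mul, hq.dvd_mul]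
    tauto
  have hM₁ : T₁ ^ M = 1 := by
    rw [hM, mul_left_comm, pow_mul, pow_orderOf_eq_one, one_pow]
  have hM₂ : T₂ ^ M = 1 := by
    rw [hM, ← mul_assoc, pow_mul', pow_orderOf_eq_one, one_pow]
  have hM₃ : T₃ ^ M = μ ^ M := hM ▸ hpow₃ _
  have hMsupp : (T₃ ^ M).support = μ.support := by rw [hM₃, support_pow_coprime hMq]
  have hMcyc : (T₃ ^ M).IsCycle := by rw [hM₃]; exact hμc.pow_iff.2 hMq
  obtain ⟨a₁, b₁, hP₁⟩ := hh₁.exists_piece hK₁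
  obtain ⟨a₂, b₂, hP₂⟩ := hh₂.exists_piece hK₂
  set P₁ := K₁.toPiece hK₁ a₁ b₁ with hP₁def
  set P₂ := K₂.toPiece hK₂ a₂ b₂ with hP₂def
  -- `K₃` supplies a single handle, so both indices mark it; only `false` will be used.
  set P₃ := K₃.toPiece hK₃ (fun _ => α) (fun _ => β) with hP₃def
  have hT₁ : (P₁.y * P₁.x⁻¹) ^ M = 1 := by
    rw [hP₁def, Diagram.toPiece_mul_inv_pow, hM₁, viaEmbedding_one]
    rfl
  have hT₂ : (P₂.y * P₂.x⁻¹) ^ M = 1 := by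
    rw [hP₂def, Diagram.toPiece_mul_inv_pow, hM₂, viaEmbedding_one]
    rfl
  have hT₃ : (P₃.y * P₃.x⁻¹) ^ M = (T₃ ^ M).viaEmbedding K₃.enum :=
    K₃.toPiece_mul_inv_pow hK₃ _ _ M
  have hmem : ∀ v ∈ μ.support, K₃.enum v ∈ ((P₃.y * P₃.x⁻¹) ^ M).support := by
    intro v hv
    rw [← hMsupp, mem_support] at hv
    have h : ((P₃.y * P₃.x⁻¹) ^ M) (K₃.enum v) = K₃.enum ((T₃ ^ M) v) := by
      rw [hT₃]
      exact viaEmbedding_apply _ _ _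
    exact mem_support.2 fun h' => hv (K₃.enum.injective (h.symm.trans h'))
  refine (Set.finite_lt_nat (Fintype.card V₃ + (Fintype.card V₁ * Fintype.card V₂ +
    2 * p * (Fintype.card V₁ + Fintype.card V₂)))).subset fun n hn => ?_
  by_contra hlt
  rw [Set.mem_ofPred_eq, not_lt] at hlt
  apply hn
  have hV₁ : 0 < Fintype.card V₁ := Fintype.card_pos_iff.2 hK₁.1
  have hV₂ : 0 < Fintype.card V₂ := Fintype.card_pos_iff.2 hK₂.1
  obtain ⟨k, l, hkl, hkl'⟩ := exists_add_eq_of_coprime hV₁ hV₂ hcop (2 * p)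
    (n - Fintype.card V₃) (by omega)
  -- One copy of `K₃` at index `0`, then `k` copies of `K₁` and `l` of `K₂`.
  let P : Fin (k + l + 1) → Piece p q r :=
    Fin.cons P₃ (Fin.append (fun _ : Fin k => P₁) (fun _ : Fin l => P₂))
  have hPi : ∀ i, i ≠ 0 → P i = P₁ ∨ P i = P₂ := by
    intro i
    refine Fin.cases (fun h => absurd rfl h) (fun j _ => ?_) i
    refine Fin.addCases (fun j => ?_) (fun j => ?_) j
    · left; simp [P]
    · right; simp [P]
  have hsize : ∑ i, (P i).size = n := by
    rw [Fin.sum_univ_succ, Fin.sum_univ_add]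
    simp only [P, Fin.cons_zero, Fin.cons_succ, Fin.append_left, Fin.append_right,
      Finset.sum_const, Finset.card_univ, Fintype.card_fin, smul_eq_mul]
    have e1 : P₁.size = Fintype.card V₁ := rfl
    have e2 : P₂.size = Fintype.card V₂ := rfl
    have e3 : P₃.size = Fintype.card V₃ := rfl
    rw [e1, e2, e3, hkl]
    omega
  obtain ⟨X, Y, hX, hY, hXY, halt⟩ := exists_generating_pair P hq hp3 hpq hkl'
    (M := M) (s := K₃.enum i) (t := K₃.enum j)
    (Diagram.handleAt_toPiece hK₃ hh₃) (K₃.enum.injective.ne hh₃.1)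
    (fun i hi => (hPi i hi).elim (fun h => h ▸ hP₁) (fun h => h ▸ hP₂))
    (fun i hi => (hPi i hi).elim (fun h => by rw [h, hT₁]) (fun h => by rw [h, hT₂]))
    (by
      change ((P₃.y * P₃.x⁻¹) ^ M).IsCycle
      rw [hT₃]
      exact isCycle_viaEmbedding hMcyc _)
    (by
      change ((P₃.y * P₃.x⁻¹) ^ M).support.card = q
      rw [hT₃]
      exact (card_support_viaEmbedding _ _).trans (by rw [hMsupp, hμq]))
    hcard (hmem i hi)
    (by
      change K₃.arcX.viaEmbedding K₃.enum (K₃.enum i) ∈ ((P₃.y * P₃.x⁻¹) ^ M).support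
      rw [viaEmbedding_apply]
      exact hmem _ hXi)
    (hmem j hj)
    (by
      change K₃.arcY.viaEmbedding K₃.enum (K₃.enum j) ∈ ((P₃.y * P₃.x⁻¹) ^ M).support
      rw [viaEmbedding_apply]
      exact hmem _ hYj)
    (K₃.enum.injective.ne hiα) (K₃.enum.injective.ne hiβ)
    (K₃.enum.injective.ne hjα) (K₃.enum.injective.ne hjβ)
  exact exists_surjective_hom (hp.odd_of_ne_two (by omega)) (hq.odd_of_ne_two (by omega))
    (by simpa using hsize) hX hY hXY halt
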